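/- Let $f\in\mathbb{C}[z]$ be a polynomial of degree $n\ge 2$. For a polynomial $g$ of degree at least $2$ let $K_g\subset\mathbb{C}$ be the set of points with bounded forward orbit under $g$, and let $J_g=\partial K_g$ be the Julia set of $g$. Let $\Sigma$ be the group of rotational symmetries of $J_f$, that is, of all rotations $\sigma(z)=\zeta+c(z-\zeta)$ with $\zeta,c\in\mathbb{C}$, $|c|=1$, such that $\sigma(J_f)=J_f$. Write $f^i$ for the $i$-fold composition of $f$ with itself. Then for every integer $i\ge 1$ $$\{g\in\mathbb{C}[z] : \deg g=n^i,\ J_g=J_f\}=\{\sigma\circ f^i : \sigma\in\Sigma\}.$$ If moreover $f$ is centered, i.e. its coefficient of $z^{n-1}$ is zero, then $\Sigma$ consists exactly of the maps $z\mapsto cz$ with $c\in\mathbb{C}$, $cJ_f=J_f$, so that for every $i\ge 1$ $$\{g\in\mathbb{C}[z] : \deg g=n^i,\ J_g=J_f\}=\{c\,f^i : c\in\mathbb{C},\ cJ_f=J_f\}.$$ -/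

import Mathlib

open Polynomial

/-- The filled-in Julia set of a complex polynomial: the points with bounded forward orbit. -/
def filledJuliaSet (f : ℂ[X]) : Set ℂ :=
  {z | Bornology.IsBounded (Set.range fun k : ℕ => (fun w => f.eval w)^[k] z)}

/-- The Julia set of a polynomial (of degree at least two): the boundary of the filled-in
Julia set. -/
def juliaSet (f : ℂ[X]) : Set ℂ :=
  frontier (filledJuliaSet f)

/-- The polynomials of degree `m` with the same Julia set as `f`. -/
def sameJulia (f : ℂ[X]) (m : ℕ) : Set ℂ[X] :=
  {g | g.natDegree = m ∧ juliaSet g = juliaSet f}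

/-- The `i`-fold composition `f ∘ ⋯ ∘ f`, as a polynomial. -/
noncomputable def iterComp (f : ℂ[X]) (i : ℕ) : ℂ[X] :=
  f.comp^[i] X

/-- The rotation `z ↦ ζ + c (z - ζ)` of the plane about `ζ` (for `‖c‖ = 1`), as a polynomial. -/
noncomputable def rotationAbout (ζ c : ℂ) : ℂ[X] :=
  C ζ + C c * (X - C ζ)

/-- The rotational symmetries of the Julia set of `f`: the rotations of the plane, about any
centre, that map the Julia set onto itself. -/
def rotationalSymmetries (f : ℂ[X]) : Set ℂ[X] :=
  {σ | ∃ ζ c : ℂ, ‖c‖ = 1 ∧ σ = rotationAbout ζ c ∧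
    (fun z => σ.eval z) '' juliaSet f = juliaSet f}

/-- A polynomial of degree `d` is centered if its coefficient of degree `d - 1` vanishes. -/
def IsCentered (f : ℂ[X]) : Prop :=
  f.coeff (f.natDegree - 1) = 0

/-- The multipliers `c` with `c J = J`, where `J` is the Julia set of `f`. -/
def multiplierSymmetries (f : ℂ[X]) : Set ℂ :=
  {c | (fun z => c * z) '' juliaSet f = juliaSet f}

/-! ### Growth of polynomials at infinity, and a maximum principle on exterior domains. -/

section PolynomialGrowth

open Filter Topology

/-! Everything is read off the Green function `G` of `K_f`, the limit of `log⁺ |f^k| / n^k`. It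
vanishes exactly on `K_f`, satisfies `G ∘ f = n G`, and depends only on `J_f`: `K_f` is the
polynomially convex hull of `J_f`, and the Bernstein–Walsh inequality yields `G_g ∘ p ≤ N G_f`
whenever `p` has degree at most `N` and maps `K_f` into `K_g` (`greenFunction_eval_le`).

If `deg g = n^i` and `J_g = J_f`, then `G ∘ g = n^i G = G ∘ f^i`. Near infinity `exp G(w) = κ |w| +
O(1)`, so `|g|` and `|f^i|` differ by a bounded amount. A rigidity statement for polynomials of
equal degree then forces `g = c f^i + e` with `|c| = 1`, and since `f^i` is surjective, `w ↦ c w +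
e` preserves `G`. It is a rotation because no nontrivial translation preserves `G`. Conversely,
rotational symmetries of `J_f` preserve `G`, so `σ ∘ f^i` multiplies `G` by `n^i` and has filled-in
Julia set `{G = 0} = K_f`.

In the centered case, the same rigidity applied to `f ∘ σ` and `f` gives `f ∘ σ = c' f + e'`; the
coefficient of `z^(n-1)` shows that `σ` fixes the origin. -/

theorem Polynomial.exists_norm_eval_div_pow_sub_coeff_le (P : ℂ[X]) {d : ℕ}
    (hd : P.natDegree ≤ d) :
    ∃ A : ℝ, 0 ≤ A ∧ ∀ z : ℂ, 1 ≤ ‖z‖ → ‖P.eval z / z ^ d - P.coeff d‖ ≤ A / ‖z‖ := by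
  obtain ⟨A, hA⟩ := (isCompact_closedBall (0 : ℂ) 1).exists_bound_of_continuousOn
    (f := fun x => (divX (reflect d P)).eval x) (Polynomial.continuous _).continuousOn
  refine ⟨A, (norm_nonneg _).trans (hA 0 (by simp)), fun z hz => ?_⟩
  have hz0 : z ≠ 0 := by
    rintro rfl
    norm_num at hz
  have h1 : P.eval z / z ^ d = (reflect d P).eval z⁻¹ := by
    let _ : Invertible z := invertibleOfNonzero hz0
    have := eval₂_reflect_mul_pow (RingHom.id ℂ) z d P hd
    rw [invOf_eq_inv] at this
    rw [div_eq_iff (pow_ne_zero _ hz0)]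
    simpa [eval₂_eq_eval_map] using this.symm
  have h2 : (reflect d P).eval z⁻¹ = (divX (reflect d P)).eval z⁻¹ * z⁻¹ + P.coeff d := by
    conv_lhs => rw [← divX_mul_X_add (reflect d P)]
    simp [coeff_reflect]
  rw [h1, h2, add_sub_cancel_right, norm_mul, norm_inv, div_eq_mul_inv]
  gcongr
  exact hA _ (by simpa using inv_le_one_of_one_le₀ hz)

theorem Polynomial.tendsto_eval_div_pow (P : ℂ[X]) {d : ℕ} (hd : P.natDegree ≤ d) {u : ℂ}
    (hu : ‖u‖ = 1) :
    Tendsto (fun t : ℝ => P.eval (t * u) / (t * u) ^ d) atTop (𝓝 (P.coeff d)) := by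
  obtain ⟨A, -, hA⟩ := P.exists_norm_eval_div_pow_sub_coeff_le hd
  rw [tendsto_iff_norm_sub_tendsto_zero]
  refine squeeze_zero' (Eventually.of_forall fun t => norm_nonneg _) ?_
    (tendsto_const_nhds.div_atTop tendsto_id : Tendsto (fun t : ℝ => A / t) atTop (𝓝 0))
  filter_upwards [eventually_ge_atTop 1] with t ht
  have h : ‖(t : ℂ) * u‖ = t := by
    rw [norm_mul, hu, mul_one, Complex.norm_real, Real.norm_of_nonneg (by linarith)]
  have h' := hA (t * u) (by rw [h]; exact ht)
  rwa [h] at h'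

theorem Polynomial.exists_norm_eval_le (P : ℂ[X]) {d : ℕ} (hd : P.natDegree ≤ d) :
    ∃ A : ℝ, 0 ≤ A ∧ ∀ z : ℂ, ‖P.eval z‖ ≤ A * (max 1 ‖z‖) ^ d := by
  obtain ⟨A, hA0, hA⟩ := P.exists_norm_eval_div_pow_sub_coeff_le hd
  obtain ⟨B, hB⟩ := (isCompact_closedBall (0 : ℂ) 1).exists_bound_of_continuousOn
    (f := fun x => P.eval x) P.continuous.continuousOn
  have hB0 : 0 ≤ B := (norm_nonneg _).trans (hB 0 (by simp))
  refine ⟨(A + ‖P.coeff d‖) + B, by positivity, fun z => ?_⟩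
  rcases le_total ‖z‖ 1 with h | h
  · rw [max_eq_left h, one_pow, mul_one]
    have := hB z (by simpa using h)
    have := norm_nonneg (P.coeff d)
    linarith
  · rw [max_eq_right h]
    have hz : 0 < ‖z‖ := by linarith
    have h1 : ‖P.eval z / z ^ d‖ ≤ A + ‖P.coeff d‖ := by
      have := norm_le_norm_sub_add (P.eval z / z ^ d) (P.coeff d)
      have h3 := hA z h
      have : A / ‖z‖ ≤ A := div_le_self hA0 h
      linarith
    rw [norm_div, norm_pow, div_le_iff₀ (by positivity)] at h1
    have : 0 ≤ B * ‖z‖ ^ d := by positivity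
    linarith

theorem Polynomial.exists_le_norm_eval {P : ℂ[X]} (hP : P ≠ 0) :
    ∃ b R : ℝ, 0 < b ∧ 1 ≤ R ∧ ∀ z : ℂ, R ≤ ‖z‖ → b * ‖z‖ ^ P.natDegree ≤ ‖P.eval z‖ := by
  obtain ⟨A, hA0, hA⟩ := P.exists_norm_eval_div_pow_sub_coeff_le le_rfl
  have ha : 0 < ‖P.leadingCoeff‖ := by simpa using hP
  refine ⟨‖P.leadingCoeff‖ / 2, max 1 (2 * A / ‖P.leadingCoeff‖), by positivity,
    le_max_left _ _, fun z hz => ?_⟩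
  have h1 : 1 ≤ ‖z‖ := (le_max_left _ _).trans hz
  have h2 : 2 * A / ‖P.leadingCoeff‖ ≤ ‖z‖ := (le_max_right _ _).trans hz
  have hz0 : 0 < ‖z‖ := by linarith
  have h3 : A / ‖z‖ ≤ ‖P.leadingCoeff‖ / 2 := by
    rw [div_le_iff₀ ha] at h2
    rw [div_le_iff₀ hz0]
    linarith
  have h4 := hA z h1
  rw [coeff_natDegree, norm_sub_rev] at h4
  have h5 := norm_le_norm_sub_add P.leadingCoeff (P.eval z / z ^ P.natDegree)
  have h6 : ‖P.leadingCoeff‖ / 2 ≤ ‖P.eval z / z ^ P.natDegree‖ := by linarith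
  rwa [norm_div, norm_pow, le_div_iff₀ (by positivity)] at h6

/-- A polynomial of degree at least two at least doubles the modulus far from the origin. -/
theorem Polynomial.exists_escape_radius {f : ℂ[X]} (hf : 2 ≤ f.natDegree) :
    ∃ R : ℝ, 1 ≤ R ∧ ∀ z : ℂ, R ≤ ‖z‖ → 2 * ‖z‖ ≤ ‖f.eval z‖ := by
  have hf0 : f ≠ 0 := by
    rintro rfl
    simp at hf
  obtain ⟨b, R, hb, hR, h⟩ := exists_le_norm_eval hf0
  refine ⟨max R (2 / b), hR.trans (le_max_left _ _), fun z hz => ?_⟩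
  have h1 : R ≤ ‖z‖ := (le_max_left _ _).trans hz
  have h2 : 2 / b ≤ ‖z‖ := (le_max_right _ _).trans hz
  rw [div_le_iff₀ hb] at h2
  have hz1 : 1 ≤ ‖z‖ := hR.trans h1
  calc 2 * ‖z‖ ≤ (‖z‖ * b) * ‖z‖ := by gcongr
    _ = b * ‖z‖ ^ 2 := by ring
    _ ≤ b * ‖z‖ ^ f.natDegree := by gcongr
    _ ≤ _ := h z h1

/-- Maximum principle for `P / Q` on the part of `{|Q| > R}` in a large disc. The strict degree
inequality makes `P / Q` vanish at infinity, so the outer circle causes no loss. -/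
theorem Polynomial.norm_eval_le_mul_of_natDegree_lt {P Q : ℂ[X]}
    (hd : P.natDegree < Q.natDegree) {A R : ℝ} (hR : 0 < R) (hA : 0 < A)
    (h : ∀ z, ‖Q.eval z‖ = R → ‖P.eval z‖ ≤ A * ‖Q.eval z‖) {z : ℂ} (hz : R < ‖Q.eval z‖) :
    ‖P.eval z‖ ≤ A * ‖Q.eval z‖ := by
  have hQ0 : Q ≠ 0 := by
    rintro rfl
    simp at hd
  obtain ⟨b, R₁, hb, hR₁, hQ⟩ := exists_le_norm_eval hQ0
  obtain ⟨B, hB0, hB⟩ := P.exists_norm_eval_div_pow_sub_coeff_le hd.le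
  set ρ := max (max R₁ (B / (A * b))) (‖z‖ + 1) with hρ
  have hfar : ∀ w : ℂ, ρ ≤ ‖w‖ → ‖P.eval w‖ ≤ A * ‖Q.eval w‖ := by
    intro w hw
    have h1 : R₁ ≤ ‖w‖ := ((le_max_left _ _).trans (le_max_left _ _)).trans hw
    have h2 : B / (A * b) ≤ ‖w‖ := ((le_max_right _ _).trans (le_max_left _ _)).trans hw
    have hw0 : 0 < ‖w‖ := by linarith
    have h3 := hB w (hR₁.trans h1)
    rw [coeff_eq_zero_of_natDegree_lt hd, sub_zero, norm_div, norm_pow,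
      div_le_iff₀ (by positivity)] at h3
    rw [div_le_iff₀ (by positivity)] at h2
    calc ‖P.eval w‖ ≤ B / ‖w‖ * ‖w‖ ^ Q.natDegree := h3
      _ ≤ (A * b) * ‖w‖ ^ Q.natDegree := by
        gcongr
        rw [div_le_iff₀ hw0]
        linarith
      _ = A * (b * ‖w‖ ^ Q.natDegree) := by ring
      _ ≤ _ := by gcongr; exact hQ w h1
  set U : Set ℂ := {w | R < ‖Q.eval w‖} ∩ Metric.ball 0 ρ with hU
  have hclos : closure U ⊆ {w | R ≤ ‖Q.eval w‖} := by
    refine closure_minimal (fun w hw => ?_) (isClosed_le continuous_const Q.continuous.norm)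
    exact (show R < ‖Q.eval w‖ from hw.1).le
  have hopen : IsOpen U :=
    (isOpen_lt continuous_const Q.continuous.norm).inter Metric.isOpen_ball
  have hne : ∀ w ∈ closure U, Q.eval w ≠ 0 := by
    intro w hw h0
    have := hclos hw
    simp only [Set.mem_ofPred_eq, h0, norm_zero] at this
    linarith
  have hdiff : DiffContOnCl ℂ (fun w => P.eval w / Q.eval w) U :=
    ⟨fun w hw => (P.differentiable w).differentiableWithinAt.div
      (Q.differentiable w).differentiableWithinAt (hne w (subset_closure hw)),
      P.continuous.continuousOn.div Q.continuous.continuousOn hne⟩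
  have hfr : ∀ w ∈ frontier U, ‖P.eval w / Q.eval w‖ ≤ A := by
    intro w hw
    have hwc : w ∈ closure U := frontier_subset_closure hw
    rw [norm_div, div_le_iff₀ (norm_pos_iff.2 (hne w hwc))]
    by_cases hwρ : ρ ≤ ‖w‖
    · exact hfar w hwρ
    · refine h w (le_antisymm ?_ (hclos hwc))
      by_contra! hlt
      have : w ∈ U := ⟨hlt, by simpa using hwρ⟩
      rw [hopen.frontier_eq] at hw
      exact hw.2 this
  have hzU : z ∈ U := ⟨hz, by
    simp only [Metric.mem_ball, dist_zero_right]
    exact (lt_add_one _).trans_le (le_max_right _ _)⟩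
  have := Complex.norm_le_of_forall_mem_frontier_norm_le
    (Metric.isBounded_ball.subset Set.inter_subset_right) hdiff hfr (subset_closure hzU)
  rwa [norm_div, div_le_iff₀ (norm_pos_iff.2 (hne z (subset_closure hzU)))] at this

/-- A maximum principle on the exterior of a level set of the polynomial `Q`. -/
theorem Polynomial.norm_eval_le_mul_of_natDegree_le {P Q : ℂ[X]} (hQ : 0 < Q.natDegree)
    (hd : P.natDegree ≤ Q.natDegree) {A R : ℝ} (hR : 1 ≤ R) (hA : 0 < A)
    (h : ∀ z, ‖Q.eval z‖ = R → ‖P.eval z‖ ≤ A) {z : ℂ} (hz : R < ‖Q.eval z‖) :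
    ‖P.eval z‖ ≤ A * ‖Q.eval z‖ := by
  have hQz : 0 < ‖Q.eval z‖ := by linarith
  -- Comparing `P ^ j` with `Q ^ (j + 1)` makes the degree inequality strict. The price is one extra
  -- factor `|Q z|`, independent of `j`, so a ratio greater than one would be contradicted by large
  -- `j`.
  have key : ∀ j : ℕ, (‖P.eval z‖ / (A * ‖Q.eval z‖)) ^ j ≤ ‖Q.eval z‖ := by
    intro j
    have hdeg : (P ^ j).natDegree < (Q ^ (j + 1)).natDegree := by
      rw [natDegree_pow, natDegree_pow]
      nlinarith [Nat.mul_le_mul_left j hd]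
    have := norm_eval_le_mul_of_natDegree_lt (A := A ^ j) (R := R ^ (j + 1)) hdeg
      (by positivity) (by positivity) (fun w hw => by
        rw [eval_pow, norm_pow] at hw
        have hw' := (pow_left_inj₀ (norm_nonneg _) (by linarith) (Nat.succ_ne_zero j)).1 hw
        rw [eval_pow, norm_pow, eval_pow, norm_pow, hw']
        calc ‖P.eval w‖ ^ j ≤ A ^ j := by gcongr; exact h w hw'
          _ ≤ A ^ j * R ^ (j + 1) := le_mul_of_one_le_right (by positivity) (one_le_pow₀ hR))
      (z := z) (by
        rw [eval_pow, norm_pow]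
        exact pow_lt_pow_left₀ hz (by linarith) (Nat.succ_ne_zero j))
    rw [eval_pow, norm_pow, eval_pow, norm_pow] at this
    rw [div_pow, mul_pow, div_le_iff₀ (by positivity)]
    calc _ ≤ _ := this
      _ = _ := by ring
  by_contra! hlt
  have h1 : 1 < ‖P.eval z‖ / (A * ‖Q.eval z‖) := by
    rwa [one_lt_div (by positivity)]
  obtain ⟨j, hj⟩ := pow_unbounded_of_one_lt ‖Q.eval z‖ h1
  linarith [key j]

/-! ### Rigidity of polynomials whose moduli differ by a bounded amount. -/

theorem Polynomial.norm_leadingCoeff_eq_of_abs_norm_sub_le {p q : ℂ[X]} {N : ℕ} (hN : 1 ≤ N)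
    (hp : p.natDegree = N) (hq : q.natDegree = N) {T : ℝ}
    (h : ∀ z, |‖p.eval z‖ - ‖q.eval z‖| ≤ T) : ‖p.leadingCoeff‖ = ‖q.leadingCoeff‖ := by
  have h1 := (tendsto_eval_div_pow p hp.le (u := 1) (by simp)).norm.sub
    (tendsto_eval_div_pow q hq.le (u := 1) (by simp)).norm
  have h2 : Tendsto (fun t : ℝ => T / t ^ N) atTop (𝓝 0) :=
    tendsto_const_nhds.div_atTop (tendsto_pow_atTop (by omega))
  have h3 := tendsto_nhds_unique h1 (squeeze_zero_norm' (by
    filter_upwards [eventually_ge_atTop 1] with t ht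
    have ht0 : (0 : ℝ) < t := by linarith
    rw [mul_one, norm_div, norm_div, ← sub_div, norm_div, norm_norm, Real.norm_eq_abs, norm_pow,
      Complex.norm_real, Real.norm_of_nonneg ht0.le]
    gcongr
    exact h t) h2)
  have e1 : p.coeff N = p.leadingCoeff := by rw [← hp]; rfl
  have e2 : q.coeff N = q.leadingCoeff := by rw [← hq]; rfl
  rw [e1, e2] at h3
  linarith

theorem Complex.exists_norm_eq_one_pow_eq {m : ℕ} (hm : 0 < m) {w : ℂ} (hw : ‖w‖ = 1) :
    ∃ u : ℂ, ‖u‖ = 1 ∧ u ^ m = w := by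
  obtain ⟨u, hu⟩ := IsAlgClosed.exists_pow_nat_eq w hm
  refine ⟨u, ?_, hu⟩
  have : ‖u‖ ^ m = 1 := by rw [← norm_pow, hu, hw]
  exact (pow_eq_one_iff_of_nonneg (norm_nonneg _) hm.ne').1 this

/-- Polynomials whose moduli differ by a bounded amount agree up to a rotation of the plane. -/
theorem Polynomial.exists_eq_C_mul_add_C_of_abs_norm_sub_le {p q : ℂ[X]} {N : ℕ} (hN : 1 ≤ N)
    (hp : p.natDegree = N) (hq : q.natDegree = N) {T : ℝ}
    (h : ∀ z, |‖p.eval z‖ - ‖q.eval z‖| ≤ T) :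
    ∃ c e : ℂ, ‖c‖ = 1 ∧ p = C c * q + C e := by
  have hlc := norm_leadingCoeff_eq_of_abs_norm_sub_le hN hp hq h
  have hq0 : q ≠ 0 := by
    rintro rfl
    simp at hq
    omega
  have hqlc : q.leadingCoeff ≠ 0 := leadingCoeff_ne_zero.2 hq0
  set c := p.leadingCoeff / q.leadingCoeff with hc
  have hc1 : ‖c‖ = 1 := by
    rw [hc, norm_div, hlc, div_self (norm_ne_zero_iff.2 hqlc)]
  have hc0 : c ≠ 0 := by
    intro h0
    simp [h0] at hc1
  set r := p - C c * q with hr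
  suffices hr0 : r.natDegree = 0 by
    refine ⟨c, r.coeff 0, hc1, ?_⟩
    rw [← eq_C_of_natDegree_eq_zero hr0]
    ring
  by_contra hd0
  set d := r.natDegree with hd
  have hdN : d < N := by
    have hle : d ≤ N := by
      refine (natDegree_sub_le _ _).trans (max_le hp.le ?_)
      exact (natDegree_C_mul_le _ _).trans hq.le
    refine lt_of_le_of_ne hle fun heq => ?_
    have : r.coeff N = 0 := by
      rw [hr, coeff_sub, coeff_C_mul, ← hp, coeff_natDegree, hp, ← hq, coeff_natDegree, hc,
        div_mul_cancel₀ _ hqlc, sub_self]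
    rw [← heq, hd, coeff_natDegree, leadingCoeff_eq_zero] at this
    rw [this] at hd
    simp at hd
    exact hd0 hd
  have hrlc : r.leadingCoeff ≠ 0 := by
    rw [Ne, leadingCoeff_eq_zero]
    intro h0
    rw [h0] at hd
    simp at hd
    exact hd0 hd
  -- At infinity `r / (c q) ~ κ z^(d-N)`. The direction `u` is chosen so that along `z = t u` this
  -- is `|κ| t^(d-N)`, asymptotically positive real. But `Re (r / (c q)) ≤ |p / q| - 1 ≤ T / |q| =
  -- O(t^(-N))`, which forces `κ = 0` because `d > 0`.
  set κ := r.leadingCoeff / (c * q.leadingCoeff) with hκ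
  have hκ0 : κ ≠ 0 := div_ne_zero hrlc (mul_ne_zero hc0 hqlc)
  have hκn : ‖κ‖ ≠ 0 := norm_ne_zero_iff.2 hκ0
  obtain ⟨u, hu1, hu⟩ := Complex.exists_norm_eq_one_pow_eq (m := N - d) (by omega)
    (w := κ / ‖κ‖) (by rw [norm_div, Complex.norm_real, norm_norm, div_self hκn])
  have hu0 : u ≠ 0 := by
    intro h0
    simp [h0] at hu1
  -- The ratio `r / (c q)` along the ray spanned by `u`, rescaled to have a positive limit.
  have hκc : (‖κ‖ : ℂ) ≠ 0 := by exact_mod_cast hκn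
  have l1 : Tendsto (fun t : ℝ => (r.eval (t * u) / (t * u) ^ d) /
      (c * (q.eval (t * u) / (t * u) ^ N)) / u ^ (N - d)) atTop (𝓝 (‖κ‖ : ℂ)) := by
    have := ((tendsto_eval_div_pow r le_rfl hu1).div
      ((tendsto_eval_div_pow q hq.le hu1).const_mul c) (by
        rw [← hq, coeff_natDegree]; exact mul_ne_zero hc0 hqlc)).div_const (u ^ (N - d))
    have hlim : r.coeff r.natDegree / (c * q.coeff N) / u ^ (N - d) = ‖κ‖ := by
      rw [hu, ← hq, coeff_natDegree, coeff_natDegree, ← hκ]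
      field_simp
    rw [hlim] at this
    exact this
  have l2 : Tendsto (fun t : ℝ => T / t ^ d / ‖q.eval (t * u) / (t * u) ^ N‖) atTop (𝓝 0) := by
    have h1 : Tendsto (fun t : ℝ => T / t ^ d) atTop (𝓝 0) :=
      tendsto_const_nhds.div_atTop (tendsto_pow_atTop hd0)
    have := h1.div (tendsto_eval_div_pow q hq.le hu1).norm (by
        rw [← hq, coeff_natDegree]; exact norm_ne_zero_iff.2 hqlc)
    rw [zero_div] at this
    exact this
  have l3 := (Complex.continuous_re.tendsto _).comp l1
  have hle : ‖κ‖ ≤ 0 := by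
    refine le_of_tendsto_of_tendsto (by simpa using l3) l2 ?_
    obtain ⟨b, R, hb, hR, hbR⟩ := exists_le_norm_eval hq0
    filter_upwards [eventually_ge_atTop R] with t ht
    have ht1 : 1 ≤ t := hR.trans ht
    have ht0 : 0 < t := by linarith
    have htc : (t : ℂ) ≠ 0 := by exact_mod_cast ht0.ne'
    have htn : ‖(t : ℂ) * u‖ = t := by
      rw [norm_mul, hu1, mul_one, Complex.norm_real, Real.norm_of_nonneg ht0.le]
    have hqt : q.eval (t * u) ≠ 0 := by
      have := hbR (t * u) (by rw [htn]; exact ht)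
      rw [htn] at this
      exact norm_pos_iff.1 (lt_of_lt_of_le (by positivity) this)
    have hpow : t ^ N = t ^ d * t ^ (N - d) := by rw [← pow_add]; congr 1; omega
    have hpowc : ((t : ℂ) * u) ^ N = (t * u) ^ d * (t ^ (N - d) * u ^ (N - d)) := by
      rw [← mul_pow, ← pow_add]; congr 1; omega
    have e1 : (r.eval (t * u) / (t * u) ^ d) / (c * (q.eval (t * u) / (t * u) ^ N)) / u ^ (N - d)
        = ((t ^ (N - d) : ℝ) : ℂ) * (r.eval (t * u) / (c * q.eval (t * u))) := by
      rw [hpowc]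
      push_cast
      field_simp
    have e2 : T / t ^ d / ‖q.eval (t * u) / (t * u) ^ N‖ = t ^ (N - d) *
        (T / ‖q.eval (t * u)‖) := by
      rw [norm_div, norm_pow, htn, hpow]
      have : ‖q.eval (t * u)‖ ≠ 0 := norm_ne_zero_iff.2 hqt
      field_simp
    simp only [Function.comp_apply]
    rw [e1, e2, Complex.re_ofReal_mul]
    gcongr
    have hre := Complex.re_le_norm (p.eval (t * u) / (c * q.eval (t * u)))
    have e3 : p.eval (t * u) / (c * q.eval (t * u)) =
        1 + r.eval (t * u) / (c * q.eval (t * u)) := by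
      rw [hr]
      simp only [eval_sub, eval_mul, eval_C]
      field_simp
      ring
    have hn0 : 0 < ‖q.eval (t * u)‖ := norm_pos_iff.2 hqt
    have e4 : ‖p.eval (t * u) / (c * q.eval (t * u))‖ ≤ 1 + T / ‖q.eval (t * u)‖ := by
      rw [norm_div, norm_mul, hc1, one_mul, div_le_iff₀ hn0, add_mul, div_mul_cancel₀ _ hn0.ne']
      have := (abs_le.1 (h (t * u))).2
      linarith
    rw [e3] at hre e4
    rw [Complex.add_re, Complex.one_re] at hre
    linarith
  exact hκn (le_antisymm hle (norm_nonneg _))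

end PolynomialGrowth

/-! ### Filled-in Julia sets, the Green function and the Bernstein–Walsh inequality. -/

section Green

open Filter Topology

theorem eval_iterComp (f : ℂ[X]) (k : ℕ) (z : ℂ) :
    (iterComp f k).eval z = (fun w => f.eval w)^[k] z := by
  simp [iterComp, iterate_comp_eval]

theorem natDegree_iterComp (f : ℂ[X]) (k : ℕ) :
    (iterComp f k).natDegree = f.natDegree ^ k := by
  simp [iterComp, natDegree_iterate_comp]

@[simp] theorem eval_iterComp_zero (f : ℂ[X]) (z : ℂ) : (iterComp f 0).eval z = z := by
  simp [eval_iterComp]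

theorem eval_iterComp_succ (f : ℂ[X]) (k : ℕ) (z : ℂ) :
    (iterComp f (k + 1)).eval z = (iterComp f k).eval (f.eval z) := by
  simp only [eval_iterComp, Function.iterate_succ_apply]

theorem eval_iterComp_succ' (f : ℂ[X]) (k : ℕ) (z : ℂ) :
    (iterComp f (k + 1)).eval z = f.eval ((iterComp f k).eval z) := by
  simp only [eval_iterComp, Function.iterate_succ_apply']

theorem mem_filledJuliaSet {f : ℂ[X]} {z : ℂ} :
    z ∈ filledJuliaSet f ↔ ∃ M, ∀ k, ‖(iterComp f k).eval z‖ ≤ M := by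
  simp only [eval_iterComp]
  change Bornology.IsBounded (Set.range fun k : ℕ => (fun w => f.eval w)^[k] z) ↔ _
  rw [isBounded_iff_forall_norm_le]
  simp

section Escape

variable {f : ℂ[X]} {R : ℝ}

theorem norm_eval_iterComp_le_of_le (hR : 1 ≤ R) (h : ∀ z : ℂ, R ≤ ‖z‖ → 2 * ‖z‖ ≤ ‖f.eval z‖)
    {z : ℂ} {k : ℕ} (hz : ‖(iterComp f (k + 1)).eval z‖ ≤ R) :
    ‖(iterComp f k).eval z‖ ≤ R := by
  by_contra! hlt
  have := h _ hlt.le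
  rw [← eval_iterComp_succ'] at this
  linarith

theorem two_pow_mul_le_norm_eval_iterComp (hR : 1 ≤ R)
    (h : ∀ z : ℂ, R ≤ ‖z‖ → 2 * ‖z‖ ≤ ‖f.eval z‖) {z : ℂ} (hz : R ≤ ‖z‖) (k : ℕ) :
    2 ^ k * ‖z‖ ≤ ‖(iterComp f k).eval z‖ := by
  induction k with
  | zero => simp
  | succ k ih =>
    have h1 : (1 : ℝ) ≤ 2 ^ k := one_le_pow₀ (by norm_num)
    have h2 : R ≤ ‖(iterComp f k).eval z‖ := by nlinarith [norm_nonneg z]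
    rw [eval_iterComp_succ']
    have := h _ h2
    rw [pow_succ]
    linarith

theorem mem_filledJuliaSet_iff_forall_norm_le (hR : 1 ≤ R)
    (h : ∀ z : ℂ, R ≤ ‖z‖ → 2 * ‖z‖ ≤ ‖f.eval z‖) {z : ℂ} :
    z ∈ filledJuliaSet f ↔ ∀ k, ‖(iterComp f k).eval z‖ ≤ R := by
  refine ⟨fun hz k => ?_, fun hz => mem_filledJuliaSet.2 ⟨R, hz⟩⟩
  obtain ⟨M, hM⟩ := mem_filledJuliaSet.1 hz
  by_contra! hlt
  obtain ⟨j, hj⟩ := pow_unbounded_of_one_lt M (one_lt_two (α := ℝ))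
  have h1 := two_pow_mul_le_norm_eval_iterComp hR h hlt.le j
  have h2 : (iterComp f j).eval ((iterComp f k).eval z) = (iterComp f (j + k)).eval z := by
    simp only [eval_iterComp, Function.iterate_add_apply]
  rw [h2] at h1
  have h3 : (2 : ℝ) ^ j ≤ 2 ^ j * ‖(iterComp f k).eval z‖ :=
    le_mul_of_one_le_right (by positivity) (by linarith)
  linarith [hM (j + k)]

end Escape

theorem isCompact_filledJuliaSet {f : ℂ[X]} (hf : 2 ≤ f.natDegree) :
    IsCompact (filledJuliaSet f) := by
  obtain ⟨R, hR, h⟩ := exists_escape_radius hf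
  have hK : filledJuliaSet f = ⋂ k, {z | ‖(iterComp f k).eval z‖ ≤ R} := by
    ext z
    rw [mem_filledJuliaSet_iff_forall_norm_le hR h, Set.mem_iInter]
    rfl
  refine Metric.isCompact_of_isClosed_isBounded ?_ ?_
  · rw [hK]
    exact isClosed_iInter fun k => isClosed_le (Polynomial.continuous _).norm continuous_const
  · refine isBounded_iff_forall_norm_le.2 ⟨R, fun z hz => ?_⟩
    simpa using (mem_filledJuliaSet_iff_forall_norm_le hR h).1 hz 0

/-- The filled-in Julia set is the polynomially convex hull of the Julia set. -/
theorem mem_filledJuliaSet_iff_hull {f : ℂ[X]} (hf : 2 ≤ f.natDegree) {z : ℂ} :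
    z ∈ filledJuliaSet f ↔
      ∀ (P : ℂ[X]) (M : ℝ), (∀ w ∈ juliaSet f, ‖P.eval w‖ ≤ M) → ‖P.eval z‖ ≤ M := by
  have hcpt := isCompact_filledJuliaSet hf
  constructor
  · intro hz P M hM
    by_cases hzJ : z ∈ juliaSet f
    · exact hM z hzJ
    · have hzi : z ∈ interior (filledJuliaSet f) := by
        by_contra hzi
        exact hzJ ⟨subset_closure hz, hzi⟩
      exact Complex.norm_le_of_forall_mem_frontier_norm_le
        (hcpt.isBounded.subset interior_subset) P.differentiable.diffContOnCl
        (fun w hw => hM w (frontier_interior_subset hw)) (subset_closure hzi)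
  · intro h
    obtain ⟨R, hR, hesc⟩ := exists_escape_radius hf
    -- The test polynomials are the iterates of `f`, all bounded by the escape radius on the Julia
    -- set.
    refine (mem_filledJuliaSet_iff_forall_norm_le hR hesc).2 fun k => h _ _ fun w hw => ?_
    exact (mem_filledJuliaSet_iff_forall_norm_le hR hesc).1
      (hcpt.isClosed.frontier_subset hw) k

theorem filledJuliaSet_eq_of_juliaSet_eq {f g : ℂ[X]} (hf : 2 ≤ f.natDegree)
    (hg : 2 ≤ g.natDegree) (h : juliaSet f = juliaSet g) :
    filledJuliaSet f = filledJuliaSet g := by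
  ext z
  rw [mem_filledJuliaSet_iff_hull hf, mem_filledJuliaSet_iff_hull hg, h]

/-- Polynomial hulls are functorial: test the hull condition at `z` with `P.comp p`. -/
theorem mapsTo_filledJuliaSet_of_juliaSet {f p : ℂ[X]} (hf : 2 ≤ f.natDegree)
    (h : ∀ z ∈ juliaSet f, p.eval z ∈ juliaSet f) {z : ℂ} (hz : z ∈ filledJuliaSet f) :
    p.eval z ∈ filledJuliaSet f := by
  rw [mem_filledJuliaSet_iff_hull hf] at hz ⊢
  intro P M hM
  rw [← eval_comp]
  exact hz _ _ fun w hw => by rw [eval_comp]; exact hM _ (h w hw)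

/-- The Green function of the filled-in Julia set with pole at infinity. -/
noncomputable def greenFunction (f : ℂ[X]) (z : ℂ) : ℝ :=
  limUnder atTop fun k : ℕ => Real.posLog ‖(iterComp f k).eval z‖ / (f.natDegree : ℝ) ^ k

theorem exists_abs_posLog_eval_sub_le {f : ℂ[X]} (hf : 2 ≤ f.natDegree) :
    ∃ B : ℝ, ∀ z, |Real.posLog ‖f.eval z‖ - f.natDegree * Real.posLog ‖z‖| ≤ B := by
  have hf0 : f ≠ 0 := by
    rintro rfl
    simp at hf
  obtain ⟨A, hA, hup⟩ := f.exists_norm_eval_le le_rfl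
  obtain ⟨b, R, hb, hR, hlo⟩ := exists_le_norm_eval hf0
  refine ⟨max (Real.posLog A) (Real.posLog b⁻¹ + f.natDegree * Real.posLog R),
    fun z => abs_le.2 ⟨?_, ?_⟩⟩
  · rw [neg_le, neg_sub]
    refine le_trans ?_ (le_max_right _ _)
    have h0 := Real.posLog_nonneg (x := ‖f.eval z‖)
    have h1 := Real.posLog_nonneg (x := b⁻¹)
    have h2 : 0 ≤ f.natDegree * Real.posLog R :=
      mul_nonneg (Nat.cast_nonneg _) Real.posLog_nonneg
    rcases le_total ‖z‖ R with h | h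
    · have : f.natDegree * Real.posLog ‖z‖ ≤ f.natDegree * Real.posLog R := by
        gcongr
      linarith
    · have h3 : ‖z‖ ^ f.natDegree ≤ b⁻¹ * ‖f.eval z‖ := by
        rw [← div_eq_inv_mul, le_div_iff₀ hb, mul_comm]
        exact hlo z h
      have h4 := (Real.posLog_le_posLog (by positivity) h3).trans Real.posLog_mul
      rw [Real.posLog_pow] at h4
      linarith
  · refine le_trans ?_ (le_max_left _ _)
    have h4 := (Real.posLog_le_posLog (norm_nonneg _) (hup z)).trans Real.posLog_mul
    have h5 : Real.posLog (max 1 ‖z‖) = Real.posLog ‖z‖ := by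
      rw [Real.posLog_eq_log_max_one (norm_nonneg z), Real.posLog_eq_log]
      rw [abs_of_nonneg (by positivity)]
      exact le_max_left _ _
    rw [Real.posLog_pow, h5] at h4
    linarith

theorem exists_tendsto_greenFunction {f : ℂ[X]} (hf : 2 ≤ f.natDegree) :
    ∃ B : ℝ, ∀ z, |greenFunction f z - Real.posLog ‖z‖| ≤ B ∧
      Tendsto (fun k : ℕ => Real.posLog ‖(iterComp f k).eval z‖ / (f.natDegree : ℝ) ^ k) atTop
        (𝓝 (greenFunction f z)) := by
  obtain ⟨B, hB⟩ := exists_abs_posLog_eval_sub_le hf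
  have hB0 : 0 ≤ B := (abs_nonneg _).trans (hB 0)
  have hn : (2 : ℝ) ≤ f.natDegree := by exact_mod_cast hf
  -- The sum of the geometric series `B / 2 ^ k`, which bounds the telescoping increments uniformly
  -- in `z`.
  refine ⟨B / (1 - 1 / 2), fun z => ?_⟩
  have hstep : ∀ k : ℕ, dist (Real.posLog ‖(iterComp f k).eval z‖ / (f.natDegree : ℝ) ^ k)
      (Real.posLog ‖(iterComp f (k + 1)).eval z‖ / (f.natDegree : ℝ) ^ (k + 1)) ≤
        B * (1 / 2) ^ k := by
    intro k
    have h1 := hB ((iterComp f k).eval z)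
    rw [← eval_iterComp_succ'] at h1
    have h2 : Real.posLog ‖(iterComp f (k + 1)).eval z‖ / (f.natDegree : ℝ) ^ (k + 1) -
        Real.posLog ‖(iterComp f k).eval z‖ / (f.natDegree : ℝ) ^ k =
        (Real.posLog ‖(iterComp f (k + 1)).eval z‖ -
          f.natDegree * Real.posLog ‖(iterComp f k).eval z‖) / (f.natDegree : ℝ) ^ (k + 1) := by
      field_simp
      ring
    have h3 : (2 : ℝ) ^ k ≤ (f.natDegree : ℝ) ^ (k + 1) :=
      (pow_le_pow_right₀ (by norm_num) k.le_succ).trans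
        (pow_le_pow_left₀ (by norm_num) hn _)
    rw [dist_comm, Real.dist_eq, h2, abs_div,
      abs_of_pos (a := (f.natDegree : ℝ) ^ (k + 1)) (by positivity), one_div, inv_pow,
      ← div_eq_mul_inv]
    gcongr
  have hlim := (cauchySeq_of_le_geometric (1 / 2) B (by norm_num) hstep).tendsto_limUnder
  refine ⟨?_, hlim⟩
  have := dist_le_of_le_geometric_of_tendsto₀ (1 / 2) B (by norm_num) hstep hlim
  rw [dist_comm, Real.dist_eq] at this
  simpa [greenFunction] using this

theorem tendsto_greenFunction {f : ℂ[X]} (hf : 2 ≤ f.natDegree) (z : ℂ) :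
    Tendsto (fun k : ℕ => Real.posLog ‖(iterComp f k).eval z‖ / (f.natDegree : ℝ) ^ k) atTop
      (𝓝 (greenFunction f z)) := by
  obtain ⟨B, hB⟩ := exists_tendsto_greenFunction hf
  exact (hB z).2

theorem exists_abs_greenFunction_sub_posLog_le {f : ℂ[X]} (hf : 2 ≤ f.natDegree) :
    ∃ B : ℝ, ∀ z, |greenFunction f z - Real.posLog ‖z‖| ≤ B := by
  obtain ⟨B, hB⟩ := exists_tendsto_greenFunction hf
  exact ⟨B, fun z => (hB z).1⟩

theorem greenFunction_nonneg {f : ℂ[X]} (hf : 2 ≤ f.natDegree) (z : ℂ) :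
    0 ≤ greenFunction f z :=
  ge_of_tendsto' (tendsto_greenFunction hf z) fun k =>
    div_nonneg Real.posLog_nonneg (by positivity)

theorem greenFunction_eval {f : ℂ[X]} (hf : 2 ≤ f.natDegree) (z : ℂ) :
    greenFunction f (f.eval z) = f.natDegree * greenFunction f z := by
  have h1 := ((tendsto_greenFunction hf z).comp (tendsto_add_atTop_nat 1)).const_mul
    (f.natDegree : ℝ)
  refine tendsto_nhds_unique (tendsto_greenFunction hf (f.eval z)) (h1.congr fun k => ?_)
  have hn : (f.natDegree : ℝ) ≠ 0 := by
    have : f.natDegree ≠ 0 := by omega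
    exact_mod_cast this
  rw [Function.comp_apply, eval_iterComp_succ, pow_succ]
  field_simp

theorem greenFunction_eval_iterComp {f : ℂ[X]} (hf : 2 ≤ f.natDegree) (k : ℕ) (z : ℂ) :
    greenFunction f ((iterComp f k).eval z) = (f.natDegree : ℝ) ^ k * greenFunction f z := by
  induction k with
  | zero => simp
  | succ k ih => rw [eval_iterComp_succ', greenFunction_eval hf, ih, pow_succ]; ring

/-- If the Green function of `f` is multiplied by a constant greater than one under `g`, then its
zero set is the filled-in Julia set of `g`. -/
theorem mem_filledJuliaSet_iff_greenFunction_eq_zero_of_eval {f g : ℂ[X]} (hf : 2 ≤ f.natDegree)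
    {N : ℝ} (hN : 1 < N) (hg : ∀ z, greenFunction f (g.eval z) = N * greenFunction f z) {z : ℂ} :
    z ∈ filledJuliaSet g ↔ greenFunction f z = 0 := by
  obtain ⟨B, hB⟩ := exists_abs_greenFunction_sub_posLog_le hf
  have hiter : ∀ k, greenFunction f ((iterComp g k).eval z) = N ^ k * greenFunction f z := by
    intro k
    induction k with
    | zero => simp
    | succ k ih => rw [eval_iterComp_succ', hg, ih, pow_succ]; ring
  rw [mem_filledJuliaSet]
  constructor
  · rintro ⟨M, hM⟩
    by_contra hne
    have hpos : 0 < greenFunction f z := lt_of_le_of_ne (greenFunction_nonneg hf z) (Ne.symm hne)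
    obtain ⟨k, hk⟩ := pow_unbounded_of_one_lt ((Real.posLog M + B) / greenFunction f z) hN
    rw [div_lt_iff₀ hpos, ← hiter] at hk
    have h1 := (abs_le.1 (hB ((iterComp g k).eval z))).2
    have h2 := Real.posLog_le_posLog (norm_nonneg _) (hM k)
    linarith
  · intro h0
    refine ⟨Real.exp B, fun k => ?_⟩
    have h1 := (abs_le.1 (hB ((iterComp g k).eval z))).1
    rw [hiter, h0, mul_zero] at h1
    have h2 : Real.log (max 1 ‖(iterComp g k).eval z‖) ≤ B := by
      rw [← Real.posLog_eq_log_max_one (norm_nonneg _)]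
      linarith
    rw [Real.log_le_iff_le_exp (by positivity)] at h2
    exact (le_max_right _ _).trans h2

theorem mem_filledJuliaSet_iff_greenFunction_eq_zero {f : ℂ[X]} (hf : 2 ≤ f.natDegree) {z : ℂ} :
    z ∈ filledJuliaSet f ↔ greenFunction f z = 0 :=
  mem_filledJuliaSet_iff_greenFunction_eq_zero_of_eval hf
    (N := f.natDegree) (by exact_mod_cast hf) (greenFunction_eval hf)

/-- The Bernstein–Walsh inequality for the filled-in Julia set. -/
theorem norm_eval_le_mul_exp_greenFunction {f : ℂ[X]} (hf : 2 ≤ f.natDegree) {P : ℂ[X]} {d : ℕ}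
    (hd : P.natDegree ≤ d) {M : ℝ} (hM0 : 0 < M) (hM : ∀ w ∈ filledJuliaSet f, ‖P.eval w‖ ≤ M)
    (z : ℂ) : ‖P.eval z‖ ≤ M * Real.exp (d * greenFunction f z) := by
  -- The comparison polynomial `iterComp f k ^ d` needs positive degree. For constant `P` the only
  -- issue is that `K_f` is nonempty, which a fixed point of `f` settles.
  wlog hd1 : 1 ≤ d generalizing d
  · have hd0 : d = 0 := by omega
    subst hd0
    obtain ⟨a, rfl⟩ : ∃ a, P = C a := ⟨_, eq_C_of_natDegree_le_zero hd⟩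
    obtain ⟨w, hw⟩ : ∃ w, f.eval w = w := by
      obtain ⟨w, hw⟩ := IsAlgClosed.exists_root (f - X) (by
        have : (f - X).natDegree = f.natDegree :=
          natDegree_sub_eq_left_of_natDegree_lt (by rw [natDegree_X]; omega)
        intro h0
        have := natDegree_eq_of_degree_eq_some (n := 0) h0
        omega)
      exact ⟨w, by simpa [sub_eq_zero] using hw⟩
    have := hM w (mem_filledJuliaSet.2 ⟨‖w‖, fun k => by
      rw [eval_iterComp, Function.iterate_fixed hw]⟩)
    simpa using this
  by_cases hz : z ∈ filledJuliaSet f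
  · rw [(mem_filledJuliaSet_iff_greenFunction_eq_zero hf).1 hz]
    simpa using hM z hz
  obtain ⟨R, hR, hesc⟩ := exists_escape_radius hf
  set S : ℕ → Set ℂ := fun k => {w | ‖(iterComp f k).eval w‖ ≤ R} with hS
  have hSanti : Antitone S := antitone_nat_of_succ_le fun k w hw =>
    norm_eval_iterComp_le_of_le hR hesc hw
  have hSclosed : ∀ k, IsClosed (S k) := fun k =>
    isClosed_le (Polynomial.continuous _).norm continuous_const
  have hScpt : ∀ k, IsCompact (S k) := fun k =>
    Metric.isCompact_of_isClosed_isBounded (hSclosed k)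
      (isBounded_iff_forall_norm_le.2 ⟨R, fun w hw => by
        have : w ∈ S 0 := hSanti (Nat.zero_le k) hw
        simpa [hS] using this⟩)
  have hn0 : f.natDegree ≠ 0 := by omega
  -- The sublevel sets `S k` decrease to `K_f`, so by compactness `|P| < M'` on `S k` for large `k`;
  -- the slack `M' > M` is removed at the end.
  have key : ∀ M' > M, ‖P.eval z‖ ≤ M' * Real.exp (d * greenFunction f z) := by
    intro M' hM'
    have hM'0 : 0 < M' := hM0.trans hM'
    obtain ⟨k₀, hk₀⟩ := exists_subset_nhds_of_isCompact' (U := {w | ‖P.eval w‖ < M'})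
      (directed_of_isDirected_le fun i j hij => hSanti hij) hScpt hSclosed (fun w hw => by
        refine (isOpen_lt P.continuous.norm continuous_const).mem_nhds ?_
        have : w ∈ filledJuliaSet f :=
          (mem_filledJuliaSet_iff_forall_norm_le hR hesc).2 fun k =>
            (Set.mem_iInter.1 hw k : w ∈ S k)
        exact (hM w this).trans_lt hM')
    obtain ⟨k₁, hk₁⟩ : ∃ k, R < ‖(iterComp f k).eval z‖ := by
      by_contra! hall
      exact hz ((mem_filledJuliaSet_iff_forall_norm_le hR hesc).2 hall)
    have hk₁' : ∀ k, k₁ ≤ k → R < ‖(iterComp f k).eval z‖ := by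
      intro k hk
      by_contra! hle
      exact absurd (hSanti hk hle : z ∈ S k₁) (not_le.2 hk₁)
    refine ge_of_tendsto (((Real.continuous_exp.tendsto _).comp
      ((tendsto_greenFunction hf z).const_mul (d : ℝ))).const_mul M') ?_
    filter_upwards [eventually_ge_atTop k₀, eventually_ge_atTop k₁] with k h0 h1
    have hNpos : f.natDegree ^ k ≠ 0 := pow_ne_zero _ hn0
    have hkz := hk₁' k h1
    have hbig : 1 ≤ ‖(iterComp f k).eval z‖ := by linarith
    have hpos : 0 < ‖(iterComp f k).eval z‖ := by linarith
    -- The powers are chosen so that the degrees compare, at most `d * n ^ k` against exactly that.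
    -- The `n ^ k`-th root then produces `log |f^k z| / n ^ k`, which tends to the Green function.
    have hmax := norm_eval_le_mul_of_natDegree_le (P := P ^ (f.natDegree ^ k))
      (Q := iterComp f k ^ d) (A := M' ^ (f.natDegree ^ k)) (R := R ^ d) (z := z)
      (by
        rw [natDegree_pow, natDegree_iterComp]
        exact Nat.mul_pos (by omega) (Nat.pos_of_ne_zero hNpos))
      (by rw [natDegree_pow, natDegree_pow, natDegree_iterComp, mul_comm]; gcongr)
      (one_le_pow₀ hR) (pow_pos hM'0 _)
      (fun w hw => by
        rw [eval_pow, norm_pow] at hw ⊢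
        have hw' := (pow_left_inj₀ (norm_nonneg _) (by linarith) (by omega)).1 hw
        have : w ∈ S k := hw'.le
        have h2 : ‖P.eval w‖ < M' := hk₀ (hSanti h0 this)
        gcongr)
      (by rw [eval_pow, norm_pow]; exact pow_lt_pow_left₀ hkz (by linarith) (by omega))
    rw [eval_pow, norm_pow, eval_pow, norm_pow] at hmax
    refine le_of_pow_le_pow_left₀ hNpos (mul_nonneg hM'0.le (Real.exp_pos _).le) (hmax.trans_eq ?_)
    rw [mul_pow, Function.comp_apply, ← Real.exp_nat_mul,
      Real.posLog_eq_log (by rwa [abs_of_pos hpos])]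
    have : ((f.natDegree ^ k : ℕ) : ℝ) * (d * (Real.log ‖(iterComp f k).eval z‖ /
        (f.natDegree : ℝ) ^ k)) = d * Real.log ‖(iterComp f k).eval z‖ := by
      have hn0' : (f.natDegree : ℝ) ≠ 0 := by exact_mod_cast hn0
      push_cast
      field_simp
    rw [this, Real.exp_nat_mul, Real.exp_log hpos]
  refine ge_of_tendsto (x := 𝓝[>] M) (f := fun M' => M' * Real.exp (d * greenFunction f z)) ?_ ?_
  · exact ((continuous_id.mul continuous_const).tendsto M).mono_left nhdsWithin_le_nhds
  · filter_upwards [self_mem_nhdsWithin] with M' hM'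
    exact key M' hM'

/-- Bernstein–Walsh for `(iterComp g j).comp p`, bounded on `K_f` by an escape radius `R` of `g`.
After division by `(deg g) ^ j` the contribution of `log R` disappears in the limit. -/
theorem greenFunction_eval_le {f g p : ℂ[X]} (hf : 2 ≤ f.natDegree) (hg : 2 ≤ g.natDegree) {N : ℕ}
    (hp : p.natDegree ≤ N) (h : ∀ w ∈ filledJuliaSet f, p.eval w ∈ filledJuliaSet g) (z : ℂ) :
    greenFunction g (p.eval z) ≤ N * greenFunction f z := by
  obtain ⟨R, hR, hesc⟩ := exists_escape_radius hg
  have hR0 : 0 < R := by linarith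
  have hbd : ∀ j : ℕ, Real.posLog ‖(iterComp g j).eval (p.eval z)‖ / (g.natDegree : ℝ) ^ j ≤
      Real.log R * ((g.natDegree : ℝ) ^ j)⁻¹ + N * greenFunction f z := by
    intro j
    have hgj : (0 : ℝ) < (g.natDegree : ℝ) ^ j := by
      have : 0 < g.natDegree := by omega
      positivity
    have hnn : 0 ≤ ((g.natDegree ^ j * N : ℕ) : ℝ) * greenFunction f z :=
      mul_nonneg (Nat.cast_nonneg _) (greenFunction_nonneg hf z)
    have h1 := norm_eval_le_mul_exp_greenFunction hf (P := (iterComp g j).comp p)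
      (d := g.natDegree ^ j * N)
      (by rw [natDegree_comp, natDegree_iterComp]; gcongr) hR0
      (fun w hw => by
        rw [eval_comp]
        exact (mem_filledJuliaSet_iff_forall_norm_le hR hesc).1 (h w hw) j) z
    rw [eval_comp] at h1
    have h2 : Real.posLog ‖(iterComp g j).eval (p.eval z)‖ ≤
        Real.log R + ((g.natDegree ^ j * N : ℕ) : ℝ) * greenFunction f z := by
      rw [Real.posLog_eq_log_max_one (norm_nonneg _), Real.log_le_iff_le_exp (by positivity),
        Real.exp_add, Real.exp_log hR0]
      refine max_le ?_ h1
      have := Real.one_le_exp hnn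
      nlinarith
    rw [div_le_iff₀ hgj]
    refine h2.trans_eq ?_
    push_cast
    field_simp
  have hlim : Tendsto (fun j : ℕ => Real.log R * ((g.natDegree : ℝ) ^ j)⁻¹ +
      N * greenFunction f z) atTop (𝓝 (N * greenFunction f z)) := by
    have h1 : Tendsto (fun j : ℕ => (g.natDegree : ℝ) ^ j) atTop atTop :=
      tendsto_pow_atTop_atTop_of_one_lt (by exact_mod_cast hg)
    simpa using (h1.inv_tendsto_atTop.const_mul (Real.log R)).add_const (N * greenFunction f z)
  exact le_of_tendsto_of_tendsto' (tendsto_greenFunction hg _) hlim hbd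

theorem greenFunction_eq_of_filledJuliaSet_eq {f g : ℂ[X]} (hf : 2 ≤ f.natDegree)
    (hg : 2 ≤ g.natDegree) (h : filledJuliaSet f = filledJuliaSet g) :
    greenFunction f = greenFunction g := by
  funext z
  have h1 := greenFunction_eval_le hf hg (p := X) (N := 1) (by simp) (by simp [h]) z
  have h2 := greenFunction_eval_le hg hf (p := X) (N := 1) (by simp) (by simp [h]) z
  simp at h1 h2
  exact le_antisymm h2 h1

end Green

/-! ### Asymptotics of the Green function at infinity, and its symmetries. -/

section Symmetries

open Filter Topology

theorem Real.abs_log_le_two_mul_abs_sub_one {y : ℝ} (hy : |y - 1| ≤ 1 / 2) :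
    |Real.log y| ≤ 2 * |y - 1| := by
  have h := abs_le.1 hy
  have hy0 : 0 < y := by linarith
  have h1 := Real.log_le_sub_one_of_pos hy0
  have h2 := Real.one_sub_inv_le_log_of_pos hy0
  have h3 := le_abs_self (y - 1)
  have h4 := abs_nonneg (y - 1)
  refine abs_le.2 ⟨?_, by linarith⟩
  refine le_trans ?_ h2
  have h5 := neg_abs_le (y - 1)
  have h6 : 1 - y⁻¹ = (y - 1) / y := by field_simp
  rw [h6, le_div_iff₀ hy0]
  nlinarith

/-- The Green function is `log ‖w‖` up to an additive constant and an error `O(1 / ‖w‖)`. -/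
theorem exists_abs_greenFunction_sub_log_le {f : ℂ[X]} (hf : 2 ≤ f.natDegree) :
    ∃ γ A R : ℝ, 1 ≤ R ∧ A ≤ R ∧
      ∀ w : ℂ, R ≤ ‖w‖ → |greenFunction f w - Real.log ‖w‖ - γ| ≤ A / ‖w‖ := by
  have hf0 : f ≠ 0 := by
    rintro rfl
    simp at hf
  have ha : 0 < ‖f.leadingCoeff‖ := by simpa using hf0
  have hn : (2 : ℝ) ≤ f.natDegree := by exact_mod_cast hf
  obtain ⟨R₁, hR₁, hesc⟩ := exists_escape_radius hf
  obtain ⟨A, hA0, hA⟩ := f.exists_norm_eval_div_pow_sub_coeff_le le_rfl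
  obtain ⟨B, hB⟩ := exists_abs_greenFunction_sub_posLog_le hf
  set n : ℝ := (f.natDegree : ℝ) with hn'
  -- The only constant compatible with `G ∘ f = n G` and `log |f w| = n log |w| + log |a| + o(1)`,
  -- `a` being the leading coefficient: it solves `γ + log |a| = n γ`.
  set γ := Real.log ‖f.leadingCoeff‖ / (n - 1) with hγ
  set A' := 2 * (A / ‖f.leadingCoeff‖) with hA'
  set R := max R₁ A' with hR
  have hA'0 : 0 ≤ A' := by positivity
  refine ⟨γ, A', R, hR₁.trans (le_max_left _ _), le_max_right _ _, ?_⟩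
  have hD : ∀ w : ℂ, R ≤ ‖w‖ →
      |Real.log ‖f.eval w‖ - n * Real.log ‖w‖ - Real.log ‖f.leadingCoeff‖| ≤ A' / ‖w‖ := by
    intro w hw
    have h1 : R₁ ≤ ‖w‖ := (le_max_left _ _).trans hw
    have h2 : A' ≤ ‖w‖ := (le_max_right _ _).trans hw
    have hw1 : 1 ≤ ‖w‖ := hR₁.trans h1
    have hw0 : 0 < ‖w‖ := by linarith
    have hfw : ‖f.eval w‖ ≠ 0 := by linarith [hesc w h1]
    have e1 : Real.log ‖f.eval w‖ - n * Real.log ‖w‖ - Real.log ‖f.leadingCoeff‖ =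
        Real.log (‖f.eval w / w ^ f.natDegree‖ / ‖f.leadingCoeff‖) := by
      rw [norm_div, norm_pow, Real.log_div (div_ne_zero hfw (by positivity)) ha.ne',
        Real.log_div hfw (by positivity), Real.log_pow]
    have h3 := (abs_norm_sub_norm_le _ _).trans (hA w hw1)
    rw [coeff_natDegree] at h3
    have h4 : |‖f.eval w / w ^ f.natDegree‖ / ‖f.leadingCoeff‖ - 1| ≤
        A / ‖f.leadingCoeff‖ / ‖w‖ := by
      rw [← div_self ha.ne', ← sub_div, abs_div, abs_norm, div_right_comm]
      gcongr
    have h5 : A / ‖f.leadingCoeff‖ / ‖w‖ ≤ 1 / 2 := by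
      rw [div_le_iff₀ hw0]
      linarith
    rw [e1]
    refine (Real.abs_log_le_two_mul_abs_sub_one (h4.trans h5)).trans ?_
    rw [hA', mul_div_assoc]
    gcongr
  set E : ℂ → ℝ := fun w => greenFunction f w - Real.log ‖w‖ - γ with hE
  have hrec : ∀ w : ℂ, E w = (E (f.eval w) +
      (Real.log ‖f.eval w‖ - n * Real.log ‖w‖ - Real.log ‖f.leadingCoeff‖)) / n := by
    intro w
    have h1 : γ * (n - 1) = Real.log ‖f.leadingCoeff‖ := div_mul_cancel₀ _ (by linarith)
    rw [eq_div_iff (by linarith), hE]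
    simp only
    rw [greenFunction_eval hf, ← h1]
    ring
  have hE0 : ∀ w : ℂ, R ≤ ‖w‖ → |E w| ≤ B + |γ| := by
    intro w hw
    have h1 : 1 ≤ ‖w‖ := (hR₁.trans (le_max_left _ _)).trans hw
    have h2 := hB w
    rw [Real.posLog_eq_log (by rwa [abs_norm])] at h2
    exact (abs_sub _ _).trans (by linarith)
  -- Each use of `hrec` divides by `n ≥ 2`. This halves the constant term, while `A' / |w|`
  -- reproduces itself because `|f w| ≥ |w|`.
  have hiter : ∀ (k : ℕ) (w : ℂ), R ≤ ‖w‖ → |E w| ≤ (B + |γ|) / 2 ^ k + A' / ‖w‖ := by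
    intro k
    induction k with
    | zero =>
      intro w hw
      have := hE0 w hw
      have : 0 ≤ A' / ‖w‖ := by positivity
      rw [pow_zero, div_one]
      linarith
    | succ k ih =>
      intro w hw
      have h1 : R₁ ≤ ‖w‖ := (le_max_left _ _).trans hw
      have hw0 : 0 < ‖w‖ := by linarith
      have h2 : ‖w‖ ≤ ‖f.eval w‖ := by linarith [hesc w h1]
      have h3 := ih (f.eval w) (hw.trans h2)
      have h4 := hD w hw
      have h5 : A' / ‖f.eval w‖ ≤ A' / ‖w‖ := by gcongr
      rw [hrec w, abs_div, abs_of_pos (a := n) (by linarith), div_le_iff₀ (by linarith)]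
      refine (abs_add_le _ _).trans ?_
      have h6 : (B + |γ|) / 2 ^ k = 2 * ((B + |γ|) / 2 ^ (k + 1)) := by
        rw [pow_succ]
        field_simp
      have h7 : 0 ≤ (B + |γ|) / 2 ^ (k + 1) + A' / ‖w‖ := by
        have := (abs_nonneg _).trans (hE0 w hw)
        positivity
      nlinarith
  intro w hw
  have hlim : Tendsto (fun k : ℕ => (B + |γ|) / 2 ^ k + A' / ‖w‖) atTop (𝓝 (0 + A' / ‖w‖)) :=
    (tendsto_const_nhds.div_atTop
      (tendsto_pow_atTop_atTop_of_one_lt (one_lt_two (α := ℝ)))).add_const _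
  rw [zero_add] at hlim
  exact ge_of_tendsto' hlim fun k => hiter k w hw

/-- The relative error `O(1 / |w|)` in `exp G ~ κ |w|` becomes a bounded absolute error, which is
what the rigidity of moduli requires. -/
theorem exists_abs_exp_greenFunction_sub_le {f : ℂ[X]} (hf : 2 ≤ f.natDegree) :
    ∃ κ T : ℝ, 0 < κ ∧ ∀ w : ℂ, |Real.exp (greenFunction f w) - κ * ‖w‖| ≤ T := by
  obtain ⟨γ, A, R, hR, hAR, h⟩ := exists_abs_greenFunction_sub_log_le hf
  obtain ⟨B, hB⟩ := exists_abs_greenFunction_sub_posLog_le hf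
  refine ⟨Real.exp γ, max (Real.exp γ * (2 * A)) (Real.exp (B + Real.posLog R) + Real.exp γ * R),
    Real.exp_pos _, fun w => ?_⟩
  rcases le_total R ‖w‖ with hw | hw
  · refine le_trans ?_ (le_max_left _ _)
    have hw0 : 0 < ‖w‖ := by linarith
    set E := greenFunction f w - Real.log ‖w‖ - γ with hE
    have h1 : Real.exp (greenFunction f w) = Real.exp γ * ‖w‖ * Real.exp E := by
      have : greenFunction f w = γ + Real.log ‖w‖ + E := by
        rw [hE]
        ring
      rw [this, Real.exp_add, Real.exp_add, Real.exp_log hw0]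
    have h2 := h w hw
    have h3 : A / ‖w‖ ≤ 1 := by
      rw [div_le_one hw0]
      linarith
    have h4 := Real.abs_exp_sub_one_le (h2.trans h3)
    have h5 : Real.exp γ * ‖w‖ * Real.exp E - Real.exp γ * ‖w‖ =
        Real.exp γ * ‖w‖ * (Real.exp E - 1) := by ring
    rw [h1, h5, abs_mul, abs_of_pos (by positivity), mul_assoc]
    rw [le_div_iff₀ hw0] at h2
    refine mul_le_mul_of_nonneg_left ?_ (Real.exp_pos _).le
    calc ‖w‖ * |Real.exp E - 1| ≤ ‖w‖ * (2 * |E|) := by gcongr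
      _ = 2 * (|E| * ‖w‖) := by ring
      _ ≤ 2 * A := by gcongr
  · refine le_trans ?_ (le_max_right _ _)
    have h1 : Real.exp (greenFunction f w) ≤ Real.exp (B + Real.posLog R) := by
      gcongr
      have := (abs_le.1 (hB w)).2
      have := Real.posLog_le_posLog (norm_nonneg _) hw
      linarith
    have h2 : Real.exp γ * ‖w‖ ≤ Real.exp γ * R := by gcongr
    have h3 := Real.exp_pos (greenFunction f w)
    have h4 : 0 ≤ Real.exp γ * ‖w‖ := by positivity
    exact abs_le.2 ⟨by linarith [Real.exp_pos (B + Real.posLog R)], by linarith⟩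

theorem exists_eq_C_mul_add_C_of_greenFunction_eq {f : ℂ[X]} (hf : 2 ≤ f.natDegree) {p q : ℂ[X]}
    {N : ℕ} (hN : 1 ≤ N) (hp : p.natDegree = N) (hq : q.natDegree = N)
    (h : ∀ z, greenFunction f (p.eval z) = greenFunction f (q.eval z)) :
    ∃ c e : ℂ, ‖c‖ = 1 ∧ p = C c * q + C e := by
  obtain ⟨κ, T, hκ, hT⟩ := exists_abs_exp_greenFunction_sub_le hf
  refine exists_eq_C_mul_add_C_of_abs_norm_sub_le hN hp hq (T := 2 * T / κ) fun z => ?_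
  rw [le_div_iff₀ hκ, show |‖p.eval z‖ - ‖q.eval z‖| * κ = |(‖p.eval z‖ - ‖q.eval z‖) * κ| by
    rw [abs_mul, abs_of_pos hκ]]
  have h1 := abs_le.1 (hT (p.eval z))
  have h2 := abs_le.1 (hT (q.eval z))
  rw [h z] at h1
  exact abs_le.2 ⟨by linarith, by linarith⟩

@[simp] theorem eval_rotationAbout (ζ c z : ℂ) :
    (rotationAbout ζ c).eval z = ζ + c * (z - ζ) := by
  simp [rotationAbout]

theorem rotationAbout_eq (ζ c : ℂ) : rotationAbout ζ c = C c * X + C (ζ - c * ζ) := by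
  rw [rotationAbout, C_sub, C_mul]
  ring

theorem natDegree_rotationAbout {ζ c : ℂ} (hc : c ≠ 0) : (rotationAbout ζ c).natDegree = 1 := by
  rw [rotationAbout_eq, natDegree_linear hc]

/-- The rotation and its inverse both map `K_f` into itself and have degree one, so
`greenFunction_eval_le` applies in both directions. -/
theorem greenFunction_eval_of_mem_rotationalSymmetries {f σ : ℂ[X]} (hf : 2 ≤ f.natDegree)
    (hσ : σ ∈ rotationalSymmetries f) (z : ℂ) :
    greenFunction f (σ.eval z) = greenFunction f z := by
  obtain ⟨ζ, c, hc, rfl, himg⟩ := hσ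
  have hc0 : c ≠ 0 := by
    rintro rfl
    simp at hc
  have hinv : ∀ z, (rotationAbout ζ c⁻¹).eval ((rotationAbout ζ c).eval z) = z := by
    intro z
    simp only [eval_rotationAbout]
    field_simp
    ring
  have h1 := greenFunction_eval_le hf hf (natDegree_rotationAbout (ζ := ζ) hc0).le
    (fun w hw => mapsTo_filledJuliaSet_of_juliaSet hf (fun z hz => by
      rw [← himg]; exact ⟨z, hz, rfl⟩) hw) z
  have h2 := greenFunction_eval_le hf hf (natDegree_rotationAbout (ζ := ζ) (inv_ne_zero hc0)).le
    (fun w hw => mapsTo_filledJuliaSet_of_juliaSet hf (fun z hz => by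
      rw [← himg] at hz
      obtain ⟨y, hy, rfl⟩ := hz
      simp only
      rwa [hinv]) hw) ((rotationAbout ζ c).eval z)
  rw [hinv] at h2
  rw [Nat.cast_one, one_mul] at h1 h2
  exact le_antisymm h1 h2

/-- Invariance would make the Green function constant along the multiples of `e`, whereas it tends
to infinity at infinity. -/
theorem eq_zero_of_greenFunction_add_eq {f : ℂ[X]} (hf : 2 ≤ f.natDegree) {e : ℂ}
    (h : ∀ w, greenFunction f (w + e) = greenFunction f w) : e = 0 := by
  obtain ⟨κ, T, hκ, hT⟩ := exists_abs_exp_greenFunction_sub_le hf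
  have hiter : ∀ m : ℕ, greenFunction f (m * e) = greenFunction f 0 := by
    intro m
    induction m with
    | zero => simp
    | succ m ih => rw [Nat.cast_succ, add_mul, one_mul, h, ih]
  by_contra he
  have he0 : 0 < κ * ‖e‖ := mul_pos hκ (norm_pos_iff.2 he)
  obtain ⟨m, hm⟩ := exists_nat_gt ((Real.exp (greenFunction f 0) + T) / (κ * ‖e‖))
  rw [div_lt_iff₀ he0] at hm
  have h1 := (abs_le.1 (hT (m * e))).1
  rw [hiter, norm_mul, Complex.norm_natCast] at h1
  linarith

theorem image_juliaSet_eq_of_greenFunction_eq {f : ℂ[X]} (hf : 2 ≤ f.natDegree) {c e : ℂ}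
    (hc : c ≠ 0) (h : ∀ w, greenFunction f (c * w + e) = greenFunction f w) :
    (fun z => c * z + e) '' juliaSet f = juliaSet f := by
  have hK : affineHomeomorph c e hc ⁻¹' filledJuliaSet f = filledJuliaSet f := by
    ext z
    rw [Set.mem_preimage, mem_filledJuliaSet_iff_greenFunction_eq_zero hf,
      mem_filledJuliaSet_iff_greenFunction_eq_zero hf, affineHomeomorph_apply, h]
  have hJ : affineHomeomorph c e hc ⁻¹' juliaSet f = juliaSet f := by
    rw [juliaSet, Homeomorph.preimage_frontier, hK]
  have := Set.image_preimage_eq (juliaSet f) (affineHomeomorph c e hc).surjective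
  rw [hJ] at this
  exact this

theorem linear_mem_rotationalSymmetries {f : ℂ[X]} (hf : 2 ≤ f.natDegree) {c e : ℂ}
    (hc : ‖c‖ = 1) (h : ∀ w, greenFunction f (c * w + e) = greenFunction f w) :
    C c * X + C e ∈ rotationalSymmetries f := by
  have hc0 : c ≠ 0 := by
    rintro rfl
    simp at hc
  have himg := image_juliaSet_eq_of_greenFunction_eq hf hc0 h
  -- The centre is the fixed point of `w ↦ c w + e`, which could fail to exist only for a
  -- translation.
  obtain ⟨ζ, hζ⟩ : ∃ ζ, ζ - c * ζ = e := by
    by_cases hc1 : c = 1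
    · subst hc1
      have : e = 0 := eq_zero_of_greenFunction_add_eq hf (by simpa using h)
      exact ⟨0, by simp [this]⟩
    · have : 1 - c ≠ 0 := sub_ne_zero.2 (Ne.symm hc1)
      exact ⟨e / (1 - c), by field_simp⟩
  refine ⟨ζ, c, hc, by rw [rotationAbout_eq, hζ], ?_⟩
  simpa using himg

theorem exists_eval_eq {p : ℂ[X]} (hp : 0 < p.natDegree) (w : ℂ) : ∃ z, p.eval z = w := by
  obtain ⟨z, hz⟩ := IsAlgClosed.exists_root (p - C w) (by
    have : (p - C w).natDegree = p.natDegree := natDegree_sub_C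
    intro h0
    have := natDegree_eq_of_degree_eq_some (n := 0) h0
    omega)
  exact ⟨z, by simpa [sub_eq_zero] using hz⟩

theorem sameJulia_pow_eq {f : ℂ[X]} (hf : 2 ≤ f.natDegree) {i : ℕ} (hi : 1 ≤ i) :
    sameJulia f (f.natDegree ^ i) =
      {g | ∃ σ ∈ rotationalSymmetries f, g = σ.comp (iterComp f i)} := by
  have hNn : f.natDegree ≤ f.natDegree ^ i := Nat.le_self_pow (by omega) _
  ext g
  constructor
  · rintro ⟨hdeg, hJ⟩
    have hg : 2 ≤ g.natDegree := by omega
    have hG := greenFunction_eq_of_filledJuliaSet_eq hg hf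
      (filledJuliaSet_eq_of_juliaSet_eq hg hf hJ)
    have hgF : ∀ z, greenFunction f (g.eval z) = greenFunction f ((iterComp f i).eval z) := by
      intro z
      rw [greenFunction_eval_iterComp hf, ← hG, greenFunction_eval hg, hdeg]
      push_cast
      rfl
    obtain ⟨c, e, hc, hce⟩ := exists_eq_C_mul_add_C_of_greenFunction_eq hf
      (N := f.natDegree ^ i) (by omega) hdeg (natDegree_iterComp f i) hgF
    refine ⟨C c * X + C e, linear_mem_rotationalSymmetries hf hc fun w => ?_, by simpa using hce⟩
    -- Surjectivity of `f^i` turns an identity along its values into invariance on the whole plane.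
    obtain ⟨z, rfl⟩ := exists_eval_eq (p := iterComp f i) (by rw [natDegree_iterComp]; omega) w
    rw [← hgF, hce]
    simp
  · rintro ⟨σ, hσ, rfl⟩
    have hN : (1 : ℝ) < (f.natDegree : ℝ) ^ i := by exact_mod_cast (by omega : 1 < f.natDegree ^ i)
    refine ⟨?_, ?_⟩
    · obtain ⟨ζ, c, hc, rfl, -⟩ := hσ
      have hc0 : c ≠ 0 := by
        rintro rfl
        simp at hc
      rw [natDegree_comp, natDegree_rotationAbout hc0, natDegree_iterComp, one_mul]
    · have hK : filledJuliaSet (σ.comp (iterComp f i)) = filledJuliaSet f := by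
        ext z
        rw [mem_filledJuliaSet_iff_greenFunction_eq_zero hf,
          mem_filledJuliaSet_iff_greenFunction_eq_zero_of_eval hf hN fun z => by
            rw [eval_comp, greenFunction_eval_of_mem_rotationalSymmetries hf hσ,
              greenFunction_eval_iterComp hf]]
      rw [juliaSet, hK, juliaSet]

/-- Every `c ^ k` maps `K_f` into itself, so `G(c ^ k) ≤ G(1)`, while `G(c ^ k) ≥ k log⁺ |c| - B`.
-/
theorem norm_le_one_of_mapsTo_juliaSet {f : ℂ[X]} (hf : 2 ≤ f.natDegree) {c : ℂ}
    (h : ∀ z ∈ juliaSet f, c * z ∈ juliaSet f) : ‖c‖ ≤ 1 := by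
  obtain ⟨B, hB⟩ := exists_abs_greenFunction_sub_posLog_le hf
  have hJ : ∀ (k : ℕ), ∀ z ∈ juliaSet f, (C (c ^ k) * X).eval z ∈ juliaSet f := by
    intro k
    induction k with
    | zero => simp
    | succ k ih =>
      intro z hz
      have := h _ (ih z hz)
      simpa [pow_succ', mul_assoc] using this
  have hk : ∀ k : ℕ, k * Real.posLog ‖c‖ ≤ greenFunction f 1 + B := by
    intro k
    have h1 := greenFunction_eval_le hf hf ((natDegree_C_mul_le (c ^ k) X).trans natDegree_X_le)
      (fun w hw => mapsTo_filledJuliaSet_of_juliaSet hf (hJ k) hw) 1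
    have h2 := (abs_le.1 (hB (c ^ k))).1
    simp only [eval_mul, eval_C, eval_X, mul_one, Nat.cast_one, one_mul] at h1
    rw [norm_pow, Real.posLog_pow] at h2
    linarith
  have h0 : Real.posLog ‖c‖ = 0 := by
    by_contra hne
    have hpos : 0 < Real.posLog ‖c‖ := lt_of_le_of_ne Real.posLog_nonneg (Ne.symm hne)
    obtain ⟨k, hk'⟩ := exists_nat_gt ((greenFunction f 1 + B) / Real.posLog ‖c‖)
    rw [div_lt_iff₀ hpos] at hk'
    linarith [hk k]
  rwa [Real.posLog_eq_zero_iff, abs_norm] at h0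

theorem norm_eq_one_of_mem_multiplierSymmetries {f : ℂ[X]} (hf : 2 ≤ f.natDegree) {c : ℂ}
    (hc : c ∈ multiplierSymmetries f) : ‖c‖ = 1 := by
  have himg : (fun z => c * z) '' juliaSet f = juliaSet f := hc
  have hc0 : c ≠ 0 := by
    rintro rfl
    -- If `c = 0`, the Julia set lies in `{0}`, so multiplication by `2` would preserve it as well.
    have : ‖(2 : ℂ)‖ ≤ 1 := norm_le_one_of_mapsTo_juliaSet hf fun z hz => by
      have hz' := hz
      rw [← himg] at hz'
      obtain ⟨w, -, rfl⟩ := hz'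
      simpa using hz
    norm_num at this
  refine le_antisymm (norm_le_one_of_mapsTo_juliaSet hf fun z hz => ?_) ?_
  · rw [← himg]
    exact ⟨z, hz, rfl⟩
  · have : ‖c⁻¹‖ ≤ 1 := norm_le_one_of_mapsTo_juliaSet hf fun z hz => by
      rw [← himg] at hz
      obtain ⟨w, hw, rfl⟩ := hz
      simpa [hc0] using hw
    rw [norm_inv] at this
    exact (inv_le_one₀ (norm_pos_iff.2 hc0)).1 this

theorem coeff_comp_linear_natDegree_sub_one {f : ℂ[X]} (hf : 1 ≤ f.natDegree) (c e : ℂ) :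
    (f.comp (C c * X + C e)).coeff (f.natDegree - 1) =
      (f.coeff (f.natDegree - 1) + f.natDegree * f.leadingCoeff * e) * c ^ (f.natDegree - 1) := by
  have h1 : f.comp (C c * X + C e) = (taylor e f).comp (C c * X) := by
    rw [taylor_apply, comp_assoc]
    simp
  rw [h1, comp_C_mul_X_coeff, taylor_coeff]
  congr 1
  have h2 : (hasseDeriv (f.natDegree - 1) f).natDegree ≤ 1 :=
    (natDegree_hasseDeriv_le _ _).trans (by omega)
  rw [eq_X_add_C_of_natDegree_le_one h2, hasseDeriv_coeff, hasseDeriv_coeff,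
    Nat.add_sub_cancel' hf, zero_add, Nat.choose_self, Nat.choose_symm hf, Nat.choose_one_right]
  simp
  ring

theorem rotationalSymmetries_eq_of_isCentered {f : ℂ[X]} (hf : 2 ≤ f.natDegree)
    (hcent : IsCentered f) :
    rotationalSymmetries f = {σ | ∃ c ∈ multiplierSymmetries f, σ = C c * X} := by
  ext σ
  constructor
  · intro hσ
    have hG := greenFunction_eval_of_mem_rotationalSymmetries hf hσ
    obtain ⟨ζ, c, hc, rfl, himg⟩ := hσ
    have hc0 : c ≠ 0 := by
      rintro rfl
      simp at hc
    obtain ⟨c', e', -, hce⟩ := exists_eq_C_mul_add_C_of_greenFunction_eq hf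
      (p := f.comp (rotationAbout ζ c)) (q := f) (N := f.natDegree) (by omega)
      (by rw [natDegree_comp, natDegree_rotationAbout hc0, mul_one]) rfl
      (fun z => by rw [eval_comp, greenFunction_eval hf, greenFunction_eval hf, hG])
    -- Since `n - 1 ≥ 1`, the constant `e'` does not contribute in this degree and the right-hand
    -- side vanishes; the left-hand side is a nonzero multiple of `ζ - c * ζ`.
    have hcoeff := congrArg (fun p : ℂ[X] => p.coeff (f.natDegree - 1)) hce
    rw [rotationAbout_eq, coeff_comp_linear_natDegree_sub_one (by omega), coeff_add, coeff_C_mul,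
      coeff_C_of_ne_zero (by omega), show f.coeff (f.natDegree - 1) = 0 from hcent] at hcoeff
    have hf0 : f ≠ 0 := by
      rintro rfl
      simp at hf
    have hn0 : f.natDegree ≠ 0 := by omega
    have he : ζ - c * ζ = 0 := by simpa [hc0, hf0, hn0] using hcoeff
    refine ⟨c, ?_, by rw [rotationAbout_eq, he]; simp⟩
    have : (fun z => (rotationAbout ζ c).eval z) = fun z => c * z := by
      funext z
      rw [rotationAbout_eq, he]
      simp
    rwa [this] at himg
  · rintro ⟨c, hc, rfl⟩
    refine ⟨0, c, norm_eq_one_of_mem_multiplierSymmetries hf hc, by simp [rotationAbout], ?_⟩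
    have himg : (fun z => c * z) '' juliaSet f = juliaSet f := hc
    simpa using himg

end Symmetries

theorem proposition7 (f : ℂ[X]) (n : ℕ) (hn : 2 ≤ n) (hf : f.natDegree = n) :
    (∀ i : ℕ, 1 ≤ i →
      sameJulia f (n ^ i) = {g | ∃ σ ∈ rotationalSymmetries f, g = σ.comp (iterComp f i)}) ∧
    (IsCentered f →
      rotationalSymmetries f = {σ | ∃ c ∈ multiplierSymmetries f, σ = C c * X} ∧
      ∀ i : ℕ, 1 ≤ i →
        sameJulia f (n ^ i) = {g | ∃ c ∈ multiplierSymmetries f, g = C c * iterComp f i}) := by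
  subst hf
  refine ⟨fun i hi => sameJulia_pow_eq hn hi, fun hcent => ?_⟩
  have hrot := rotationalSymmetries_eq_of_isCentered hn hcent
  refine ⟨hrot, fun i hi => ?_⟩
  rw [sameJulia_pow_eq hn hi, hrot]
  ext g
  constructor
  · rintro ⟨σ, ⟨c, hc, rfl⟩, rfl⟩
    exact ⟨c, hc, by simp⟩
  · rintro ⟨c, hc, rfl⟩
    exact ⟨_, ⟨c, hc, rfl⟩, by simp⟩
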